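/- Let $p$ be an odd prime, let $p-1=ef$ with $f$ even, let $g$ be a primitive root modulo $p^2$, and let $b\ge 0$ be an integer. For $j\in\{1,2\}$ and $0\le l<fp^{j-1}$ put $$D_l^{(p^j,f)}=\{g^{l}\cdot g^{kfp^{j-1}} \bmod p^j : 0\le k<e\},$$ and let $$\mathcal C_1=\bigcup_{i=0}^{f/2-1}p\,D^{(p,f)}_{(i+b)\bmod f}\ \cup\ \bigcup_{i=0}^{pf/2-1}D^{(p^2,f)}_{(i+b)\bmod pf}\ \cup\ \{0\},\qquad \mathcal C_0=\{0,1,\dots,p^2-1\}\setminus \mathcal C_1 ,$$ where $pD=\{pv: v\in D\}$. Let $(s_n)_{n\ge 0}$ be the binary sequence of period $p^2$ over $\mathbb F_2$ with $s_n=1$ if $n \bmod p^2\in\mathcal C_1$ and $s_n=0$ if $n\bmod p^2\in\mathcal C_0$. The linear complexity over $\mathbb F_2$ of a periodic sequence $(t_n)$ is the least $L\ge 0$ for which there are $c_0,\dots,c_{L-1}\in\mathbb F_2$, with $c_0\ne 0$ if $L>0$, such that $t_{n+L}=c_{L-1}t_{n+L-1}+\dots+c_0t_n$ for all $n\ge 0$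 (so it is $0$ for the zero sequence). The $k$-error linear complexity $LC_k((s_n))$ is the smallest linear complexity that can be obtained by changing at most $k$ terms of $(s_n)$ per period (of length $p^2$). Suppose that $2$ is a primitive root modulo $p^2$. If $p\equiv 3\pmod 8$, then $$LC_k((s_n))=\begin{cases}p^2,& k=0,\\ p^2-1,& 1\le k<(p-1)/2,\\ p^2-p,&(p-1)/2\le k<(p^2-p)/2,\\ p-1,& k=(p^2-p)/2,\\ 1,& k=(p^2-1)/2,\\ 0,& k\ge (p^2+1)/2.\end{cases}$$ If $p\equiv 5\pmod 8$, then $$LC_k((s_n))=\begin{cases}p^2,& k=0,\\ p^2-1,& 1\le k<(p-1)/2,\\ p^2-p+1,& k=(p-1)/2,\\ p^2-p,&(p+1)/2\le k<(p^2-p)/2,\\ p,& k=(p^2-p)/2,\\ 1,& k=(p^2-1)/2,\\ 0,& k\ge (p^2+1)/2.\end{cases}$$ -/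

import Mathlib

/-- The generalized cyclotomic class `D_l^{(p^j,f)} = {g^l * g^(k f p^(j-1)) mod p^j : 0 ≤ k < e}`
(where `p - 1 = e f`), as a set of least non-negative residues. -/
def cycClass (p e f g j l : ℕ) : Finset ℕ :=
  (Finset.range e).image fun k => (g ^ l * g ^ (k * f * p ^ (j - 1))) % p ^ j

/-- The support set
`C₁ = ⋃_{0 ≤ i < f/2} p D_{i+b mod f}^{(p,f)} ∪ ⋃_{0 ≤ i < pf/2} D_{i+b mod pf}^{(p²,f)} ∪ {0}`. -/
def cycSupport (p e f g b : ℕ) : Finset ℕ :=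
  ((Finset.range (f / 2)).biUnion fun i =>
      (cycClass p e f g 1 ((i + b) % f)).image fun v => p * v) ∪
    ((Finset.range (p * f / 2)).biUnion fun i => cycClass p e f g 2 ((i + b) % (p * f))) ∪
    {0}

/-- The generalized cyclotomic binary sequence of period `p²`: `s n = 1` if `n mod p² ∈ C₁`, and
`s n = 0` otherwise. When `p` is an odd prime, `p - 1 = e f`, `f` is even and `g` is a primitive root
modulo `p²`, the classes partition `ℤ/p²` minus `0`, so the complement of `C₁` is
`C₀ = ⋃_{f/2 ≤ i < f} p D_{i+b mod f}^{(p,f)} ∪ ⋃_{pf/2 ≤ i < pf} D_{i+b mod pf}^{(p²,f)}`. -/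
def cycSeq (p e f g b : ℕ) (n : ℕ) : ZMod 2 :=
  if n % p ^ 2 ∈ cycSupport p e f g b then 1 else 0

/-- `s` satisfies a linear recurrence `s (n+L) = c_{L-1} s (n+L-1) + ⋯ + c_0 s n` (`n ≥ 0`) of
order `L` with `c_0 ≠ 0`. For `L = 0` this says that `s` is the zero sequence. -/
def HasRecurrenceOfOrder {F : Type*} [Field F] (s : ℕ → F) (L : ℕ) : Prop :=
  ∃ E : LinearRecurrence F,
    E.order = L ∧ (∀ i : Fin E.order, (i : ℕ) = 0 → E.coeffs i ≠ 0) ∧ E.IsSolution s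

/-- The linear complexity of a (periodic) sequence: the least order of such a recurrence.
A `T`-periodic sequence with `T > 0` always has one, namely `s (n+T) = s n`. -/
noncomputable def linearComplexity {F : Type*} [Field F] (s : ℕ → F) : ℕ :=
  sInf {L | HasRecurrenceOfOrder s L}

/-- The `k`-error linear complexity of a `T`-periodic sequence `s`: the least linear complexity of
a `T`-periodic sequence `t` that differs from `s` in at most `k` terms per period. -/
noncomputable def kErrorLinearComplexity {F : Type*} [Field F] (T : ℕ) (s : ℕ → F) (k : ℕ) : ℕ :=
  sInf {L | ∃ t : ℕ → F, Function.Periodic t T ∧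
    Set.ncard {i : ℕ | i < T ∧ t i ≠ s i} ≤ k ∧ linearComplexity t = L}

/-! Write `p = 2q + 1`. As 2 is a primitive root modulo `p ^ 2`, and hence modulo `p`, `X ^ p ^ 2 -
1 = (X - 1) Φ_p Φ_{p²}` is a factorization over `F₂` into distinct irreducibles. Each factor adds
its degree to the linear complexity of a `p ^ 2`-periodic `t` unless its cofactor kills `t`: `X - 1`
drops out iff the period sum is 0, `Φ_p` iff the sums over the residue classes mod `p` all agree,
`Φ_{p²}` iff `t` has period `p` (`linearComplexity_of_periodic_sq`).

The sequence matters only through its ones per residue class mod `p`: `q + 1` in the `q + 1` classes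
of a set `M`, and `q` in the others (`cycSeq_isClassBalanced`). All thresholds then follow by
counting. The number of ones is odd, so `X - 1` drops out iff the number of changes is odd;
equalizing class parities costs one change throughout `M` or throughout its complement; period `p`
costs at least `q` changes in every class. The two cases of the theorem differ by the parity of `q`.
-/

open Polynomial

/-! ### Linear complexity through the annihilator ideal -/

/-- The left shift `t ↦ (n ↦ t (n + 1))` on sequences. -/
def seqShift (F : Type*) [Field F] : Module.End F (ℕ → F) := LinearMap.funLeft F F Nat.succ

lemma seqShift_pow_apply {F : Type*} [Field F] (i : ℕ) (t : ℕ → F) (n : ℕ) :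
    (seqShift F ^ i) t n = t (n + i) := by
  induction i generalizing n with
  | zero => simp
  | succ i ih =>
    rw [pow_succ', Module.End.mul_apply]
    change (seqShift F ^ i) t (n + 1) = _
    rw [ih]; congr 1; ring

/-- The ideal of polynomials in the shift that annihilate a sequence. -/
def seqAnnihilator {F : Type*} [Field F] (t : ℕ → F) : Ideal F[X] where
  carrier := {q | aeval (seqShift F) q t = 0}
  zero_mem' := by simp
  add_mem' {a b} ha hb := by
    simp only [Set.mem_ofPred_eq] at *
    simp [ha, hb]
  smul_mem' a b hb := by
    simp only [Set.mem_ofPred_eq, smul_eq_mul, map_mul, Module.End.mul_apply] at *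
    simp [hb]

lemma mem_seqAnnihilator {F : Type*} [Field F] {t : ℕ → F} {q : F[X]} :
    q ∈ seqAnnihilator t ↔ aeval (seqShift F) q t = 0 := Iff.rfl

lemma charPoly_mem_seqAnnihilator {F : Type*} [Field F] (E : LinearRecurrence F) (t : ℕ → F) :
    E.charPoly ∈ seqAnnihilator t ↔ E.IsSolution t := by
  rw [mem_seqAnnihilator, funext_iff]
  refine forall_congr' fun n => ?_
  simp only [LinearRecurrence.charPoly, ← C_mul_X_pow_eq_monomial, map_sub, map_sum, map_mul,
    map_pow, aeval_X, map_one, one_mul, aeval_C, LinearMap.sub_apply, LinearMap.sum_apply,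
    Module.End.mul_apply, Module.algebraMap_end_apply, Pi.sub_apply, Finset.sum_apply,
    Pi.smul_apply, seqShift_pow_apply, smul_eq_mul, Pi.zero_apply, sub_eq_zero]

lemma hasRecurrenceOfOrder_natDegree {F : Type*} [Field F] {t : ℕ → F} {q : F[X]}
    (hq : q.Monic) (h0 : q.coeff 0 ≠ 0) (ht : q ∈ seqAnnihilator t) :
    HasRecurrenceOfOrder t q.natDegree := by
  refine ⟨⟨q.natDegree, fun i => -q.coeff i⟩, rfl, fun i hi => by simpa [hi] using h0, ?_⟩
  rw [← charPoly_mem_seqAnnihilator]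
  convert ht
  rw [LinearRecurrence.charPoly]
  simp only [map_neg, Finset.sum_neg_distrib, sub_neg_eq_add]
  conv_rhs => rw [q.as_sum_range' (q.natDegree + 1) (Nat.lt_succ_self _), Finset.sum_range_succ,
    ← Fin.sum_univ_eq_sum_range (fun i => monomial i (q.coeff i)), add_comm]
  rw [hq.coeff_natDegree]

/-- Recurrences are monic annihilators with nonzero constant term. The normalized generator is one
of these, so requiring `c_0 ≠ 0` does not raise the minimum. -/
lemma linearComplexity_eq_natDegree {F : Type*} [Field F] {t : ℕ → F} {m : F[X]}
    (hm : seqAnnihilator t = Ideal.span {m}) (h0 : m.coeff 0 ≠ 0) :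
    linearComplexity t = m.natDegree := by
  have hm0 : m ≠ 0 := by rintro rfl; simp at h0
  have hlc : m.leadingCoeff⁻¹ ≠ 0 := inv_ne_zero (leadingCoeff_ne_zero.2 hm0)
  have hmem : HasRecurrenceOfOrder t m.natDegree := by
    rw [← natDegree_mul_leadingCoeff_self_inv m]
    refine hasRecurrenceOfOrder_natDegree (monic_mul_leadingCoeff_inv hm0) ?_ ?_
    · simpa using ⟨h0, hm0⟩
    · rw [hm, Ideal.mem_span_singleton]
      exact dvd_mul_right _ _
  refine le_antisymm (Nat.sInf_le hmem) (le_csInf ⟨_, hmem⟩ ?_)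
  rintro L ⟨E, rfl, -, hE⟩
  have := (charPoly_mem_seqAnnihilator E t).2 hE
  rw [hm, Ideal.mem_span_singleton] at this
  have h := natDegree_le_of_dvd this E.charPoly_monic.ne_zero
  rwa [natDegree_eq_of_degree_eq_some E.charPoly_degree_eq_order] at h

open Classical in
-- Either `A` divides `m` and is split off, or it is coprime to `m` and `m' = m`. The last clause
-- transfers divisibility tests from `m` to `m'`, so that the factors can be peeled off one after
-- another.
lemma natDegree_eq_add_of_dvd_mul {F : Type*} [Field F] {m A Q : F[X]} (hA : Irreducible A)
    (hm : m ≠ 0) (h : m ∣ A * Q) (hAQ : IsCoprime A Q) :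
    ∃ m', m' ≠ 0 ∧ m' ∣ Q ∧ m.natDegree = (if m ∣ Q then 0 else A.natDegree) + m'.natDegree ∧
      ∀ R, IsCoprime A R → (m ∣ A * R ↔ m' ∣ R) := by
  by_cases hd : A ∣ m
  · obtain ⟨m', rfl⟩ := hd
    have hm' : m' ≠ 0 := right_ne_zero_of_mul hm
    refine ⟨m', hm', (mul_dvd_mul_iff_left hA.ne_zero).1 h, ?_, fun R _ =>
      mul_dvd_mul_iff_left hA.ne_zero⟩
    rw [natDegree_mul hA.ne_zero hm', if_neg]
    intro hh
    exact hA.not_isUnit (hAQ.isUnit_of_dvd' dvd_rfl ((dvd_mul_right _ _).trans hh))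
  · have hc : IsCoprime m A := ((hA.coprime_iff_not_dvd).2 hd).symm
    have hQ : m ∣ Q := hc.dvd_of_dvd_mul_left h
    exact ⟨m, hm, hQ, by simp [hQ], fun R _ =>
      ⟨fun h => hc.dvd_of_dvd_mul_left h, fun h => h.mul_left _⟩⟩

open Classical in
theorem linearComplexity_eq_of_mul_mem {F : Type*} [Field F] {t : ℕ → F} {A B C : F[X]}
    (hA : Irreducible A) (hB : Irreducible B) (hC : Irreducible C)
    (hAB : IsCoprime A B) (hAC : IsCoprime A C) (hBC : IsCoprime B C)
    (h0 : (A * (B * C)).coeff 0 ≠ 0) (ht : A * (B * C) ∈ seqAnnihilator t) :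
    linearComplexity t = (if B * C ∈ seqAnnihilator t then 0 else A.natDegree) +
      ((if A * C ∈ seqAnnihilator t then 0 else B.natDegree) +
      (if A * B ∈ seqAnnihilator t then 0 else C.natDegree)) := by
  set m := Submodule.IsPrincipal.generator (seqAnnihilator t)
  have hm : seqAnnihilator t = Ideal.span {m} := (Ideal.span_singleton_generator _).symm
  have hmem : ∀ q, q ∈ seqAnnihilator t ↔ m ∣ q := fun q => by
    rw [hm, Ideal.mem_span_singleton]
  simp only [hmem] at ht ⊢
  have hm0' : m.coeff 0 ≠ 0 := by
    obtain ⟨r, hr⟩ := ht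
    rw [hr, mul_coeff_zero] at h0
    exact left_ne_zero_of_mul h0
  have hm0 : m ≠ 0 := by intro h; simp [h] at hm0'
  rw [linearComplexity_eq_natDegree hm hm0']
  obtain ⟨m₁, h1, h1d, h1e, h1R⟩ := natDegree_eq_add_of_dvd_mul hA hm0 ht (hAB.mul_right hAC)
  obtain ⟨m₂, h2, h2d, h2e, h2R⟩ := natDegree_eq_add_of_dvd_mul hB h1 h1d hBC
  obtain ⟨m₃, h3, h3d, h3e, -⟩ := natDegree_eq_add_of_dvd_mul (Q := 1) hC h2 (by simpa using h2d)
    isCoprime_one_right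
  have h3' : m₃.natDegree = 0 := natDegree_eq_zero_of_isUnit (isUnit_of_dvd_one h3d)
  rw [h1e, h2e, h3e, h3', h1R C hAC, h1R B hAB, ← h2R 1 isCoprime_one_right, mul_one, add_zero]

/-! ### Primitive roots and the factorization of `X ^ p ^ 2 - 1` over `F₂` -/

/-- If `a ^ d ≡ 1` mod `p` then `a ^ (p * d) ≡ 1` mod `p ^ 2`, so `p (p - 1) ∣ p d`; Fermat gives
the converse divisibility. -/
lemma orderOf_natCast_zmod_prime {p : ℕ} (hp : p.Prime)
    {a : ℕ} (h : orderOf (a : ZMod (p ^ 2)) = Nat.totient (p ^ 2)) :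
    orderOf (a : ZMod p) = p - 1 := by
  have : Fact p.Prime := ⟨hp⟩
  have hN : Nat.totient (p ^ 2) = p * (p - 1) := by
    rw [Nat.totient_prime_pow hp (by norm_num)]; norm_num
  have hp1 : 0 < p - 1 := Nat.sub_pos_of_lt hp.one_lt
  set d := orderOf (a : ZMod p) with hd
  have h1 : (a : ZMod (p ^ 2)) ^ (p * d) = 1 := by
    have : (a : ZMod p) ^ d = 1 := pow_orderOf_eq_one _
    have h2 : a ^ d ≡ 1 [MOD p] := by
      rw [← ZMod.natCast_eq_natCast_iff]; push_cast; simpa using this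
    have h3 : (a ^ d : ℤ) ≡ 1 [ZMOD (p : ℤ)] := by exact_mod_cast (Int.natCast_modEq_iff.2 h2)
    have h4 : ((p : ℤ) ^ (1 + 1)) ∣ ((a : ℤ) ^ d) ^ (p ^ 1) - 1 ^ (p ^ 1) :=
      dvd_sub_pow_of_dvd_sub (R := ℤ) (p := p) (by
        have := h3.symm.dvd; simpa using this) 1
    have h5 := (ZMod.intCast_zmod_eq_zero_iff_dvd (((a : ℤ) ^ d) ^ (p ^ 1) - 1 ^ (p ^ 1)) (p ^ 2)).2
      (by push_cast; exact h4)
    push_cast at h5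
    simp only [pow_one, one_pow] at h5
    rw [mul_comm, pow_mul]
    exact sub_eq_zero.1 h5
  have h2 := orderOf_dvd_of_pow_eq_one h1
  rw [h, hN] at h2
  have h3 : p - 1 ∣ d := Nat.dvd_of_mul_dvd_mul_left hp.pos h2
  refine Nat.dvd_antisymm ?_ h3
  -- The default `orderOf = 0` would mean `p ∣ a`, whence `a ^ 2 = 0` mod `p ^ 2`, although `a` is a
  -- unit there.
  have hdpos : 0 < d := by
    rcases Nat.eq_zero_or_pos d with h0 | h0
    · exfalso
      have hne : (a : ZMod p) = 0 := by
        by_contra hne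
        exact (orderOf_pos_iff.2 (isOfFinOrder_iff_pow_eq_one.2
          ⟨p - 1, hp1, ZMod.pow_card_sub_one_eq_one hne⟩)).ne' h0
      have hpa : p ∣ a := (ZMod.natCast_eq_zero_iff a p).1 hne
      have : (a : ZMod (p ^ 2)) ^ 2 = 0 := by
        rw [← Nat.cast_pow, ZMod.natCast_eq_zero_iff]; exact pow_dvd_pow_of_dvd hpa 2
      have ho := pow_orderOf_eq_one (a : ZMod (p ^ 2))
      have hpos : 0 < p * (p - 1) := Nat.mul_pos hp.pos hp1
      rw [h, hN] at ho
      have : Fact (1 < p ^ 2) := ⟨Nat.one_lt_pow (by norm_num) hp.one_lt⟩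
      have : IsUnit (a : ZMod (p ^ 2)) := IsUnit.of_pow_eq_one ho hpos.ne'
      have := this.pow 2
      simp_all
    · exact h0
  refine orderOf_dvd_of_pow_eq_one (ZMod.pow_card_sub_one_eq_one ?_)
  intro h0
  have hpow : (a : ZMod p) ^ d = 1 := pow_orderOf_eq_one (a : ZMod p)
  rw [h0, zero_pow hdpos.ne'] at hpow
  exact zero_ne_one hpow

/-- Irreducible factors of `Φ_n` over `F₂` have degree the order of 2 mod `n`, here the full degree.
-/
lemma irreducible_cyclotomic_zmod_two {n : ℕ} (hn : ¬ 2 ∣ n)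
    (h : orderOf (2 : ZMod n) = n.totient) : Irreducible (cyclotomic n (ZMod 2)) := by
  refine ZMod.irreducible_of_dvd_cyclotomic_of_natDegree hn dvd_rfl ?_
  rw [natDegree_cyclotomic, ← h, ← orderOf_units]
  simp

lemma aeval_seqShift_sum {F : Type*} [Field F] (t : ℕ → F) (n k : ℕ) (d : ℕ) :
    aeval (seqShift F) (∑ i ∈ Finset.range k, (X ^ d) ^ i : F[X]) t n =
      ∑ i ∈ Finset.range k, t (n + d * i) := by
  simp [map_sum, LinearMap.sum_apply, ← pow_mul, seqShift_pow_apply]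

lemma periodic_sum_range {F : Type*} [AddCommGroup F] {t : ℕ → F} {k : ℕ} {T : ℕ}
    (ht : Function.Periodic t (T * k)) (n : ℕ) :
    ∑ i ∈ Finset.range k, t (n + T + T * i) = ∑ i ∈ Finset.range k, t (n + T * i) := by
  have h1 := Finset.sum_range_succ (fun i => t (n + T * i)) k
  rw [Finset.sum_range_succ'] at h1
  simp only [mul_zero, add_zero, ht n, add_left_inj] at h1
  rw [← h1]
  refine Finset.sum_congr rfl fun i _ => ?_
  congr 1; ring

open Classical in
/-- The linear complexity of a binary sequence of period `p ^ 2`, where `2` is a primitive root. -/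
theorem linearComplexity_of_periodic_sq {p : ℕ} (hp : p.Prime) (hodd : ¬ 2 ∣ p)
    (h2 : orderOf (2 : ZMod (p ^ 2)) = Nat.totient (p ^ 2)) {t : ℕ → ZMod 2}
    (ht : Function.Periodic t (p ^ 2)) :
    linearComplexity t = (if ∑ i ∈ Finset.range (p ^ 2), t i = 0 then 0 else 1) +
      ((if ∀ n, ∑ j ∈ Finset.range p, t (n + 1 + p * j) = ∑ j ∈ Finset.range p, t (n + p * j)
        then 0 else p - 1) +
      (if Function.Periodic t p then 0 else p ^ 2 - p)) := by
  have : Fact p.Prime := ⟨hp⟩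
  have h2p : orderOf (2 : ZMod p) = p - 1 := by
    simpa using orderOf_natCast_zmod_prime hp (a := 2) (by simpa using h2)
  have hB : Irreducible (cyclotomic p (ZMod 2)) :=
    irreducible_cyclotomic_zmod_two hodd (by rw [h2p, Nat.totient_prime hp])
  have hC : Irreducible (cyclotomic (p ^ 2) (ZMod 2)) :=
    irreducible_cyclotomic_zmod_two (fun h => hodd (Nat.prime_two.dvd_of_dvd_pow h)) h2
  have hA : Irreducible (X - 1 : (ZMod 2)[X]) := by simpa using irreducible_X_sub_C (1 : ZMod 2)
  have hCe : cyclotomic (p ^ 2) (ZMod 2) = ∑ i ∈ Finset.range p, (X ^ p) ^ i := by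
    simpa using cyclotomic_prime_pow_eq_geom_sum (R := ZMod 2) (n := 1) hp
  have hBA : (X - 1) * cyclotomic p (ZMod 2) = X ^ p - 1 := by
    rw [mul_comm, cyclotomic_prime_mul_X_sub_one]
  have hABC : (X - 1) * (cyclotomic p (ZMod 2) * cyclotomic (p ^ 2) (ZMod 2)) = X ^ p ^ 2 - 1 := by
    have := cyclotomic_prime_pow_mul_X_pow_sub_one (ZMod 2) p 1
    rw [← mul_assoc, hBA, mul_comm]
    simpa using this
  have hBCe : cyclotomic p (ZMod 2) * cyclotomic (p ^ 2) (ZMod 2) =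
      ∑ i ∈ Finset.range (p ^ 2), (X ^ 1) ^ i := by
    refine mul_left_cancel₀ hA.ne_zero (hABC.trans ?_)
    rw [pow_one, mul_geom_sum]
  have hNne : ((p ^ 2 : ℕ) : ZMod 2) ≠ 0 := by
    rw [Ne, ZMod.natCast_eq_zero_iff]
    exact fun h => hodd (Nat.prime_two.dvd_of_dvd_pow h)
  -- Separability, from `p ^ 2` being odd, makes the three factors pairwise coprime.
  have hsep : (X ^ p ^ 2 - 1 : (ZMod 2)[X]).Separable := X_pow_sub_one_separable_iff.2 hNne
  rw [← hABC] at hsep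
  have hcop := hsep.isCoprime
  have hAB := hcop.of_mul_right_left
  have hAC := hcop.of_mul_right_right
  have hBC := (hsep.of_mul_right).isCoprime
  have hshift : ∀ T, (X ^ T - 1 : (ZMod 2)[X]) ∈ seqAnnihilator t ↔ Function.Periodic t T := by
    intro T
    rw [mem_seqAnnihilator, funext_iff]
    simp [Function.Periodic, seqShift_pow_apply, sub_eq_zero]
  rw [linearComplexity_eq_of_mul_mem hA hB hC hAB hAC hBC
    (by rw [hABC]; simp [coeff_X_pow, (pow_pos hp.pos 2).ne])
    (by rw [hABC, hshift]; exact ht), hBA, hshift]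
  have e1 : (X - 1 : (ZMod 2)[X]).natDegree = 1 := by
    simpa using natDegree_X_sub_C (1 : ZMod 2)
  have e3 : (cyclotomic (p ^ 2) (ZMod 2)).natDegree = p ^ 2 - p := by
    rw [natDegree_cyclotomic, Nat.totient_prime_pow hp (by norm_num), Nat.mul_sub]
    simp [sq]
  rw [e1, e3, natDegree_cyclotomic, Nat.totient_prime hp]
  congr 1
  · refine if_congr ?_ rfl rfl
    -- The cofactor of `X - 1` is `1 + X + ⋯ + X ^ (p ^ 2 - 1)`: it sums over a window of one
    -- period, wherever that starts.
    rw [hBCe, mem_seqAnnihilator, funext_iff]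
    simp only [aeval_seqShift_sum, Pi.zero_apply]
    refine ⟨fun h => by simpa using h 0, fun h n => ?_⟩
    induction n with
    | zero => simpa using h
    | succ n ih => rw [periodic_sum_range (by simpa using ht), ih]
  congr 1
  refine if_congr ?_ rfl rfl
  -- `Φ_{p²}` sums over a residue class mod `p`; `X - 1` then compares neighbouring classes.
  rw [hCe, mem_seqAnnihilator, funext_iff]
  refine forall_congr' fun n => ?_
  rw [map_mul, Module.End.mul_apply]
  have : ∀ u : ℕ → ZMod 2, aeval (seqShift (ZMod 2)) (X - 1 : (ZMod 2)[X]) u n = u (n + 1) - u n := by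
    intro u
    simp only [map_sub, aeval_X, map_one, LinearMap.sub_apply, Pi.sub_apply, Module.End.one_apply]
    rfl
  rw [this, aeval_seqShift_sum, aeval_seqShift_sum, Pi.zero_apply, sub_eq_zero]

/-! ### Counting changes by residue class modulo `p` -/

/-- The elements of `{0, …, p ^ 2 - 1}` congruent to `r` modulo `p`. -/
def residueClass (p r : ℕ) : Finset ℕ := (Finset.range (p ^ 2)).filter fun n => n % p = r

/-- The number of places in the residue class `r` modulo `p` where `s` and `t` differ. -/
def classDist (p : ℕ) (s t : ℕ → ZMod 2) (r : ℕ) : ℕ :=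
  ((residueClass p r).filter fun n => t n ≠ s n).card

lemma sum_residueClass {p r : ℕ} (hr : r < p) {A : Type*} [AddCommMonoid A] (t : ℕ → A) :
    ∑ n ∈ residueClass p r, t n = ∑ j ∈ Finset.range p, t (r + p * j) := by
  have hp : 0 < p := by omega
  refine Finset.sum_nbij' (fun n => n / p) (fun j => r + p * j) ?_ ?_ ?_ ?_ ?_
  · intro n hn
    simp only [residueClass, Finset.mem_filter, Finset.mem_range] at hn ⊢
    exact Nat.div_lt_of_lt_mul (by rw [← sq]; exact hn.1)
  · intro j hj
    simp only [residueClass, Finset.mem_filter, Finset.mem_range] at hj ⊢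
    refine ⟨?_, by simp [Nat.mod_eq_of_lt hr]⟩
    have : p * (j + 1) ≤ p * p := Nat.mul_le_mul_left _ hj
    nlinarith
  · intro n hn
    simp only [residueClass, Finset.mem_filter, Finset.mem_range] at hn
    rw [← hn.2]; exact Nat.mod_add_div n p
  · intro j hj
    simp [Nat.add_mul_div_left _ _ hp, Nat.div_eq_of_lt hr]
  · intro n hn
    simp only [residueClass, Finset.mem_filter, Finset.mem_range] at hn
    rw [← hn.2, Nat.mod_add_div]

lemma card_residueClass {p r : ℕ} (hr : r < p) : (residueClass p r).card = p := by
  rw [Finset.card_eq_sum_ones, sum_residueClass hr]; simp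

lemma sum_range_sq_eq {p : ℕ} (hp : 0 < p) {A : Type*} [AddCommMonoid A] (t : ℕ → A) :
    ∑ n ∈ Finset.range (p ^ 2), t n =
      ∑ r ∈ Finset.range p, ∑ n ∈ residueClass p r, t n :=
  (Finset.sum_fiberwise_of_maps_to (fun n _ => Finset.mem_range.2 (Nat.mod_lt n hp)) t).symm

lemma ncard_ne_eq_sum_classDist {p : ℕ} (hp : 0 < p) (s t : ℕ → ZMod 2) :
    Set.ncard {i : ℕ | i < p ^ 2 ∧ t i ≠ s i} = ∑ r ∈ Finset.range p, classDist p s t r := by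
  have : {i : ℕ | i < p ^ 2 ∧ t i ≠ s i} =
      ((Finset.range (p ^ 2)).filter fun i => t i ≠ s i : Finset ℕ) := by
    ext; simp
  rw [this, Set.ncard_coe_finset, Finset.card_filter, sum_range_sq_eq hp]
  simp [classDist, Finset.card_filter]

lemma sum_zmod_two_eq (A : Finset ℕ) (s t : ℕ → ZMod 2) :
    ∑ n ∈ A, t n =
      (((A.filter fun n => s n = 1).card + (A.filter fun n => t n ≠ s n).card : ℕ) : ZMod 2) := by
  have key : ∀ a b : ZMod 2, a = (if b = 1 then 1 else 0) + (if a ≠ b then 1 else 0) := by decide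
  rw [Finset.card_filter, Finset.card_filter, Nat.cast_add, Nat.cast_sum, Nat.cast_sum,
    ← Finset.sum_add_distrib]
  refine Finset.sum_congr rfl fun n _ => ?_
  push_cast
  exact key _ _

/-- A binary sequence of odd period `p ^ 2 = (2 q + 1) ^ 2` that has `q + 1` ones in the residue
classes modulo `p` from a set `M` of `q + 1` classes, and `q` ones in each of the others. -/
structure IsClassBalanced (p q : ℕ) (s : ℕ → ZMod 2) (M : Finset ℕ) : Prop where
  eq_two_mul_add_one : p = 2 * q + 1
  pos : 0 < q
  periodic : Function.Periodic s (p ^ 2)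
  subset : M ⊆ Finset.range p
  card_eq : M.card = q + 1
  card_ones : ∀ r < p,
    ((residueClass p r).filter fun n => s n = 1).card = q + if r ∈ M then 1 else 0

namespace IsClassBalanced

variable {p q : ℕ} {s t : ℕ → ZMod 2} {M : Finset ℕ}

lemma p_pos (h : IsClassBalanced p q s M) : 0 < p := by have := h.1; omega

lemma sum_ones (h : IsClassBalanced p q s M) :
    ∑ r ∈ Finset.range p, (q + if r ∈ M then 1 else 0) = p * q + (q + 1) := by
  rw [Finset.sum_add_distrib, ← Finset.card_filter, Finset.filter_mem_eq_inter,
    Finset.inter_eq_right.2 h.subset, h.card_eq]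
  simp

lemma exists_mem (h : IsClassBalanced p q s M) : ∃ r < p, r ∈ M := by
  obtain ⟨r, hr⟩ := Finset.card_pos.1 (by rw [h.card_eq]; omega : 0 < M.card)
  exact ⟨r, Finset.mem_range.1 (h.subset hr), hr⟩

lemma card_sdiff (h : IsClassBalanced p q s M) : (Finset.range p \ M).card = q := by
  rw [Finset.card_sdiff_of_subset h.subset, h.card_eq, Finset.card_range, h.1]; omega

lemma exists_not_mem (h : IsClassBalanced p q s M) : ∃ r < p, r ∉ M := by
  obtain ⟨r, hr⟩ := Finset.card_pos.1 (by rw [h.card_sdiff]; exact h.2 :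
    0 < (Finset.range p \ M).card)
  simp only [Finset.mem_sdiff, Finset.mem_range] at hr
  exact ⟨r, hr⟩

lemma sum_class (h : IsClassBalanced p q s M) (t : ℕ → ZMod 2) {r : ℕ} (hr : r < p) :
    ∑ n ∈ residueClass p r, t n =
      ((q + (if r ∈ M then 1 else 0) + classDist p s t r : ℕ) : ZMod 2) := by
  rw [sum_zmod_two_eq _ s t, h.card_ones r hr]; rfl

/-- `s` has `p q + q + 1 = 2 (q² + q) + 1` ones per period, an odd number. -/
lemma sum_period (h : IsClassBalanced p q s M) (t : ℕ → ZMod 2) :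
    ∑ n ∈ Finset.range (p ^ 2), t n =
      ((1 + ∑ r ∈ Finset.range p, classDist p s t r : ℕ) : ZMod 2) := by
  rw [sum_range_sq_eq h.p_pos, Finset.sum_congr rfl fun r hr =>
    h.sum_class t (Finset.mem_range.1 hr), ← Nat.cast_sum, Finset.sum_add_distrib, h.sum_ones,
    ZMod.natCast_eq_natCast_iff]
  refine Nat.ModEq.add_right _ ?_
  rw [h.1, Nat.ModEq, show (2 * q + 1) * q + (q + 1) = 1 + 2 * (q * q + q) by ring,
    Nat.add_mul_mod_self_left]

open Classical in
/-- The linear complexity of `t` in terms of its distances to `s` on the residue classes. -/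
theorem linearComplexity_eq (h : IsClassBalanced p q s M) (hp : p.Prime)
    (h2 : orderOf (2 : ZMod (p ^ 2)) = Nat.totient (p ^ 2)) (ht : Function.Periodic t (p ^ 2)) :
    linearComplexity t =
      (if (∑ r ∈ Finset.range p, classDist p s t r) % 2 = 1 then 0 else 1) +
      ((if ∃ a, ∀ r < p, (q + (if r ∈ M then 1 else 0) + classDist p s t r) % 2 = a
        then 0 else p - 1) +
      (if Function.Periodic t p then 0 else p ^ 2 - p)) := by
  rw [linearComplexity_of_periodic_sq hp (by rw [h.1]; omega) h2 ht, h.sum_period]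
  congr 1
  · refine if_congr ?_ rfl rfl
    rw [ZMod.natCast_eq_zero_iff]; omega
  congr 1
  refine if_congr ?_ rfl rfl
  have hper : Function.Periodic (fun n => ∑ j ∈ Finset.range p, t (n + p * j)) p := fun n =>
    periodic_sum_range (by rwa [← sq]) n
  have hcl : ∀ n, ∑ j ∈ Finset.range p, t (n + p * j) =
      ((q + (if n % p ∈ M then 1 else 0) + classDist p s t (n % p) : ℕ) : ZMod 2) := fun n => by
    rw [← h.sum_class t (Nat.mod_lt n h.p_pos), sum_residueClass (Nat.mod_lt n h.p_pos)]
    exact (hper.map_mod_nat n).symm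
  simp only [hcl, ZMod.natCast_eq_natCast_iff, Nat.ModEq]
  constructor
  · intro hn
    refine ⟨(q + (if 0 % p ∈ M then 1 else 0) + classDist p s t (0 % p)) % 2, fun r hr => ?_⟩
    have : ∀ n, (q + (if n % p ∈ M then 1 else 0) + classDist p s t (n % p)) % 2 =
        (q + (if 0 % p ∈ M then 1 else 0) + classDist p s t (0 % p)) % 2 := by
      intro n
      induction n with
      | zero => rfl
      | succ n ih => rw [hn, ih]
    simpa [Nat.mod_eq_of_lt hr] using this r
  · rintro ⟨a, ha⟩ n
    rw [ha _ (Nat.mod_lt _ h.p_pos), ha _ (Nat.mod_lt _ h.p_pos)]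

/-- A `p`-periodic `t` is constant on a class, so it disagrees with either the zeros or the ones of
`s` there, `q` and `q + 1` in number in some order. The cheap choice follows the majority, which is
1 exactly on `M`. -/
lemma classDist_of_periodic (h : IsClassBalanced p q s M) (ht : Function.Periodic t p) {r : ℕ}
    (hr : r < p) : classDist p s t r =
      if (t r = 1 ↔ r ∈ M) then q else q + 1 := by
  have hc : ∀ n ∈ residueClass p r, t n = t r := fun n hn => by
    rw [← (Finset.mem_filter.1 hn).2]; exact (ht.map_mod_nat n).symm
  have h1 := h.card_ones r hr
  have h3 := card_residueClass hr
  have h4 := Finset.card_filter_add_card_filter_not (s := residueClass p r) (fun n => s n = 1)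
  have h5 := h.1
  have key : ∀ a : ZMod 2, a ≠ 1 → a = 0 := by decide
  have key' : ∀ a : ZMod 2, 0 ≠ a ↔ a = 1 := by decide
  by_cases h0 : t r = 1
  · have : classDist p s t r = ((residueClass p r).filter fun n => ¬ s n = 1).card := by
      rw [classDist]; congr 1
      refine Finset.filter_congr fun n hn => ?_
      rw [hc n hn, h0, ne_comm]
    simp only [h0, true_iff]
    split_ifs at * <;> omega
  · have : classDist p s t r = ((residueClass p r).filter fun n => s n = 1).card := by
      rw [classDist]; congr 1
      refine Finset.filter_congr fun n hn => ?_
      rw [hc n hn, key _ h0, key']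
    simp only [h0, false_iff]
    split_ifs at * <;> omega

end IsClassBalanced

lemma kErrorLinearComplexity_eq {F : Type*} [Field F] {T k v : ℕ} {s : ℕ → F}
    (hex : ∃ t : ℕ → F, Function.Periodic t T ∧ Set.ncard {i : ℕ | i < T ∧ t i ≠ s i} ≤ k ∧
      linearComplexity t ≤ v)
    (hlb : ∀ t : ℕ → F, Function.Periodic t T → Set.ncard {i : ℕ | i < T ∧ t i ≠ s i} ≤ k →
      v ≤ linearComplexity t) :
    kErrorLinearComplexity T s k = v := by
  obtain ⟨t, ht, hk, hv⟩ := hex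
  refine le_antisymm (le_trans (Nat.sInf_le ⟨t, ht, hk, rfl⟩) hv) ?_
  refine le_csInf ⟨linearComplexity t, t, ht, hk, rfl⟩ ?_
  rintro L ⟨t, ht, hk, rfl⟩
  exact hlb t ht hk

/-- The sequence `s` with the first term of each residue class in `S` modulo `p` flipped. -/
def flipClasses (p : ℕ) (s : ℕ → ZMod 2) (S : Finset ℕ) (n : ℕ) : ZMod 2 :=
  s n + if n % p ^ 2 < p ∧ n % p ∈ S then 1 else 0

lemma flipClasses_periodic {p : ℕ} {s : ℕ → ZMod 2} (hs : Function.Periodic s (p ^ 2))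
    (S : Finset ℕ) : Function.Periodic (flipClasses p s S) (p ^ 2) := by
  intro n
  have : (n + p ^ 2) % p = n % p := by rw [sq, Nat.add_mul_mod_self_left]
  simp only [flipClasses, hs n, this, Nat.add_mod_right]

lemma classDist_flipClasses {p r : ℕ} (hr : r < p) (s : ℕ → ZMod 2) (S : Finset ℕ) :
    classDist p s (flipClasses p s S) r = if r ∈ S then 1 else 0 := by
  have h : ((residueClass p r).filter fun n => flipClasses p s S n ≠ s n) =
      if r ∈ S then {r} else ∅ := by
    ext n
    have hrp : r < p ^ 2 := lt_of_lt_of_le hr (by nlinarith)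
    simp only [flipClasses, Finset.mem_filter, residueClass, Finset.mem_range, ne_eq,
      add_eq_left, ite_eq_right_iff, one_ne_zero, imp_false, not_not]
    split_ifs with hS
    · rw [Finset.mem_singleton]
      constructor
      · rintro ⟨⟨h1, h2⟩, h3, -⟩
        rwa [Nat.mod_eq_of_lt h1, ← Nat.mod_eq_iff_lt (by omega), h2, eq_comm] at h3
      · rintro rfl
        simp [hrp, Nat.mod_eq_of_lt hr, Nat.mod_eq_of_lt hrp, hr, hS]
    · simp only [Finset.notMem_empty, iff_false]
      rintro ⟨⟨-, rfl⟩, -, h⟩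
      exact hS h
  rw [classDist, h]
  split_ifs <;> rfl

lemma sum_classDist_flipClasses {p : ℕ} (s : ℕ → ZMod 2) {S : Finset ℕ}
    (hS : S ⊆ Finset.range p) :
    ∑ r ∈ Finset.range p, classDist p s (flipClasses p s S) r = S.card := by
  rw [Finset.sum_congr rfl fun r hr => classDist_flipClasses (Finset.mem_range.1 hr) s S,
    ← Finset.card_filter, Finset.filter_mem_eq_inter, Finset.inter_eq_right.2 hS]

/-! ### The values of the `k`-error linear complexity -/

namespace IsClassBalanced

variable {p q : ℕ} {s t : ℕ → ZMod 2} {M : Finset ℕ}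

lemma le_sum_classDist_of_periodic (h : IsClassBalanced p q s M) (ht : Function.Periodic t p) :
    p * q ≤ ∑ r ∈ Finset.range p, classDist p s t r := by
  have := Finset.card_nsmul_le_sum (Finset.range p) (classDist p s t) q fun r hr => by
    rw [h.classDist_of_periodic ht (Finset.mem_range.1 hr)]; split_ifs <;> omega
  simpa using this

/-- The class sums of `s` have opposite parities on `M` and off `M`, so a common parity forces a
change in each of the `q + 1` classes of `M` or in each of the `q` others. -/
lemma le_sum_classDist_of_parity (h : IsClassBalanced p q s M)
    (ht : ∃ a, ∀ r < p, (q + (if r ∈ M then 1 else 0) + classDist p s t r) % 2 = a) :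
    q ≤ ∑ r ∈ Finset.range p, classDist p s t r := by
  obtain ⟨a, ha⟩ := ht
  by_cases hq : (q + 1) % 2 = a
  · refine le_trans ?_ (Finset.sum_le_sum_of_subset (Finset.sdiff_subset (t := M)))
    have := Finset.card_nsmul_le_sum (Finset.range p \ M) (classDist p s t) 1 fun r hr => by
      rw [Finset.mem_sdiff, Finset.mem_range] at hr
      have := ha r hr.1
      rw [if_neg hr.2] at this
      omega
    simpa [h.card_sdiff] using this
  · refine le_trans ?_ (Finset.sum_le_sum_of_subset h.subset)
    have : M.card • 1 ≤ ∑ r ∈ M, classDist p s t r := Finset.card_nsmul_le_sum M (classDist p s t) 1 fun r hr => by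
      have := ha r (Finset.mem_range.1 (h.subset hr))
      rw [if_pos hr] at this
      omega
    rw [h.card_eq] at this
    simp only [smul_eq_mul, mul_one] at this
    omega

lemma two_mul_le_sq (h : IsClassBalanced p q s M) : p + p ≤ p ^ 2 := by
  have := h.1; have := h.2; nlinarith

lemma classDist_eq_of_sum_le (h : IsClassBalanced p q s M) (ht : Function.Periodic t p)
    (hD : ∑ r ∈ Finset.range p, classDist p s t r ≤ p * q) {r : ℕ} (hr : r < p) :
    classDist p s t r = q := by
  have hle : ∀ r ∈ Finset.range p, q ≤ classDist p s t r := fun r hr => by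
    rw [h.classDist_of_periodic ht (Finset.mem_range.1 hr)]; split_ifs <;> omega
  have heq : ∑ r ∈ Finset.range p, q = ∑ r ∈ Finset.range p, classDist p s t r :=
    le_antisymm (Finset.sum_le_sum hle) (by simpa using hD)
  exact ((Finset.sum_eq_sum_iff_of_le hle).1 heq r (Finset.mem_range.2 hr)).symm

variable (h : IsClassBalanced p q s M) (hp : p.Prime)
    (h2 : orderOf (2 : ZMod (p ^ 2)) = Nat.totient (p ^ 2))

include h hp h2

theorem kErrorLinearComplexity_zero :
    kErrorLinearComplexity (p ^ 2) s 0 = p ^ 2 := by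
  have hpp := h.p_pos
  have hsq := h.two_mul_le_sq
  have hq := h.2
  refine kErrorLinearComplexity_eq ⟨s, h.periodic, by simp, ?_⟩ fun t ht hk => ?_
  · rw [h.linearComplexity_eq hp h2 h.periodic]
    split_ifs <;> omega
  · rw [h.linearComplexity_eq hp h2 ht, ncard_ne_eq_sum_classDist hpp] at *
    rw [if_neg (by omega), if_neg fun hc => ?_, if_neg fun hc => ?_]
    · omega
    · have := h.le_sum_classDist_of_periodic hc
      nlinarith
    · have := h.le_sum_classDist_of_parity hc
      omega

theorem kErrorLinearComplexity_of_lt {k : ℕ} (hk1 : 1 ≤ k) (hkq : k < q) :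
    kErrorLinearComplexity (p ^ 2) s k = p ^ 2 - 1 := by
  have hpp := h.p_pos
  have hsq := h.two_mul_le_sq
  have hq := h.2
  -- Any single change makes the period sum 0; fewer than `q` changes cannot remove the other two
  -- factors.
  refine kErrorLinearComplexity_eq ⟨_, flipClasses_periodic h.periodic {0}, ?_, ?_⟩
    fun t ht hk => ?_
  · rw [ncard_ne_eq_sum_classDist hpp, sum_classDist_flipClasses _ (by simpa using hpp)]
    simpa using hk1
  · rw [h.linearComplexity_eq hp h2 (flipClasses_periodic h.periodic _),
      sum_classDist_flipClasses _ (by simpa using hpp), if_pos (by simp)]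
    split_ifs <;> omega
  · rw [h.linearComplexity_eq hp h2 ht, ncard_ne_eq_sum_classDist hpp] at *
    rw [add_comm, if_neg fun hc => ?_, if_neg fun hc => ?_]
    · omega
    · have := h.le_sum_classDist_of_periodic hc
      nlinarith
    · have := h.le_sum_classDist_of_parity hc
      omega

lemma sq_sub_le_linearComplexity (ht : Function.Periodic t (p ^ 2))
    (hD : ∑ r ∈ Finset.range p, classDist p s t r < p * q) : p ^ 2 - p ≤ linearComplexity t := by
  rw [h.linearComplexity_eq hp h2 ht, ← add_assoc, if_neg (c := Function.Periodic t p) fun hc => ?_]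
  · omega
  · have := h.le_sum_classDist_of_periodic hc
    omega

/-- One change in each class off `M` equalizes the parities; `q` being odd, it also makes the period
sum 0. -/
theorem kErrorLinearComplexity_of_odd (hq : q % 2 = 1) {k : ℕ} (hk1 : q ≤ k) (hkq : k < p * q) :
    kErrorLinearComplexity (p ^ 2) s k = p ^ 2 - p := by
  have hpp := h.p_pos
  refine kErrorLinearComplexity_eq ⟨_, flipClasses_periodic h.periodic (Finset.range p \ M), ?_, ?_⟩
    fun t ht hk => ?_
  · rw [ncard_ne_eq_sum_classDist hpp, sum_classDist_flipClasses _ Finset.sdiff_subset,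
      h.card_sdiff]
    exact hk1
  · rw [h.linearComplexity_eq hp h2 (flipClasses_periodic h.periodic _),
      sum_classDist_flipClasses _ Finset.sdiff_subset, h.card_sdiff, if_pos hq, if_pos]
    · split_ifs <;> omega
    · refine ⟨0, fun r hr => ?_⟩
      rw [classDist_flipClasses hr]
      by_cases hM : r ∈ M <;> simp [hM, hr] <;> omega
  · rw [ncard_ne_eq_sum_classDist hpp] at hk
    exact h.sq_sub_le_linearComplexity hp h2 ht (by omega)

/-- Changing the `q` classes off `M` would keep the period sum at 1, so the `q + 1` classes of `M`
are changed instead. -/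
theorem kErrorLinearComplexity_of_even (hq : q % 2 = 0) {k : ℕ} (hk1 : q + 1 ≤ k)
    (hkq : k < p * q) :
    kErrorLinearComplexity (p ^ 2) s k = p ^ 2 - p := by
  have hpp := h.p_pos
  refine kErrorLinearComplexity_eq ⟨_, flipClasses_periodic h.periodic M, ?_, ?_⟩
    fun t ht hk => ?_
  · rw [ncard_ne_eq_sum_classDist hpp, sum_classDist_flipClasses _ h.subset, h.card_eq]
    exact hk1
  · rw [h.linearComplexity_eq hp h2 (flipClasses_periodic h.periodic _),
      sum_classDist_flipClasses _ h.subset, h.card_eq, if_pos (by omega), if_pos]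
    · split_ifs <;> omega
    · refine ⟨0, fun r hr => ?_⟩
      rw [classDist_flipClasses hr]
      split_ifs <;> omega
  · rw [ncard_ne_eq_sum_classDist hpp] at hk
    exact h.sq_sub_le_linearComplexity hp h2 ht (by omega)

theorem kErrorLinearComplexity_of_even_eq (hq : q % 2 = 0) :
    kErrorLinearComplexity (p ^ 2) s q = p ^ 2 - p + 1 := by
  have hpp := h.p_pos
  have hpq := h.1
  have hq0 := h.2
  refine kErrorLinearComplexity_eq ⟨_, flipClasses_periodic h.periodic (Finset.range p \ M), ?_, ?_⟩
    fun t ht hk => ?_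
  · rw [ncard_ne_eq_sum_classDist hpp, sum_classDist_flipClasses _ Finset.sdiff_subset,
      h.card_sdiff]
  · rw [h.linearComplexity_eq hp h2 (flipClasses_periodic h.periodic _), add_left_comm, if_pos]
    · split_ifs <;> omega
    · refine ⟨1, fun r hr => ?_⟩
      rw [classDist_flipClasses hr]
      by_cases hM : r ∈ M <;> simp [hM, hr] <;> omega
  · rw [ncard_ne_eq_sum_classDist hpp] at hk
    rw [h.linearComplexity_eq hp h2 ht, if_neg (c := Function.Periodic t p) fun hc => ?_]
    -- Equal parities force exactly `q` changes; this is even, so `X - 1` survives. Otherwise `Φ_p`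
    -- survives.
    · by_cases hc : ∃ a, ∀ r < p, (q + (if r ∈ M then 1 else 0) + classDist p s t r) % 2 = a
      · have := h.le_sum_classDist_of_parity hc
        rw [if_neg (by omega)]
        omega
      · rw [if_neg hc]; omega
    · have := h.le_sum_classDist_of_periodic hc
      nlinarith

theorem kErrorLinearComplexity_mul :
    kErrorLinearComplexity (p ^ 2) s (p * q) = if q % 2 = 1 then p - 1 else p := by
  have hpp := h.p_pos
  have hpq := h.1
  have hsq := h.two_mul_le_sq
  have hodd : (p * q) % 2 = q % 2 := by rw [Nat.mul_mod, hpq]; simp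
  have hper : Function.Periodic (fun n => if n % p ∈ M then 1 else 0 : ℕ → ZMod 2) p :=
    fun n => by simp
  have hper2 : Function.Periodic (fun n => if n % p ∈ M then 1 else 0 : ℕ → ZMod 2) (p ^ 2) := by
    rw [sq]; exact hper.nat_mul p
  have hd : ∀ r < p, classDist p s (fun n => if n % p ∈ M then 1 else 0) r = q := fun r hr => by
    rw [h.classDist_of_periodic hper hr, Nat.mod_eq_of_lt hr, if_pos]
    split_ifs with hM <;> simp [hM]
  have hD : ∑ r ∈ Finset.range p, classDist p s (fun n => if n % p ∈ M then 1 else 0) r = p * q := by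
    rw [Finset.sum_congr rfl fun r hr => hd r (Finset.mem_range.1 hr)]; simp
  refine kErrorLinearComplexity_eq ⟨_, hper2, ?_, ?_⟩ fun t ht hk => ?_
  · rw [ncard_ne_eq_sum_classDist hpp, hD]
  · rw [h.linearComplexity_eq hp h2 hper2, hD, hodd, if_pos hper]
    split_ifs <;> omega
  · rw [ncard_ne_eq_sum_classDist hpp] at hk
    rw [h.linearComplexity_eq hp h2 ht]
    by_cases hc : Function.Periodic t p
    -- Period `p` within this budget means exactly `q` changes in every class, so the parities on
    -- and off `M` still differ and `Φ_p` survives.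
    · have hd := fun r hr => h.classDist_eq_of_sum_le (r := r) hc hk hr
      have hD : ∑ r ∈ Finset.range p, classDist p s t r = p * q := by
        rw [Finset.sum_congr rfl fun r hr => hd r (Finset.mem_range.1 hr)]; simp
      rw [hD, hodd, if_neg (c := ∃ a, _)]
      · split_ifs <;> omega
      · rintro ⟨a, ha⟩
        obtain ⟨r, hr, hrM⟩ := h.exists_mem
        obtain ⟨r', hr', hrM'⟩ := h.exists_not_mem
        have h1 := ha r hr
        have h2 := ha r' hr'
        rw [hd _ hr, if_pos hrM] at h1
        rw [hd _ hr', if_neg hrM'] at h2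
        omega
    · rw [if_neg hc]
      split_ifs <;> omega

/-- The all-ones sequence is at distance `p q + q`, the number of zeros of `s`; the zero sequence is
one change further away. -/
theorem kErrorLinearComplexity_eq_one :
    kErrorLinearComplexity (p ^ 2) s (p * q + q) = 1 := by
  have hpp := h.p_pos
  have hpq := h.1
  have hq := h.2
  have hsq := h.two_mul_le_sq
  have hD0 : ∑ r ∈ Finset.range p, classDist p s (fun _ => 1) r = p * q + q := by
    have : ∑ r ∈ Finset.range p, (classDist p s (fun _ => 1) r + (q + if r ∈ M then 1 else 0)) =
        p * p := by
      rw [Finset.sum_congr rfl fun r hr => ?_, Finset.sum_const, Finset.card_range, smul_eq_mul]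
      rw [h.classDist_of_periodic (fun _ => rfl) (Finset.mem_range.1 hr)]
      split_ifs <;> simp_all <;> omega
    rw [Finset.sum_add_distrib, h.sum_ones] at this
    have e : p * p = p * q + p * q + p := by nth_rw 2 [hpq]; ring
    omega
  refine kErrorLinearComplexity_eq ⟨fun _ => 1, fun _ => rfl, ?_, ?_⟩ fun t ht hk => ?_
  · rw [ncard_ne_eq_sum_classDist hpp, hD0]
  · rw [h.linearComplexity_eq hp h2 (fun _ => rfl), if_pos (c := Function.Periodic _ _) fun _ => rfl,
      if_pos (c := ∃ a, _)]
    · split_ifs <;> omega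
    · refine ⟨1, fun r hr => ?_⟩
      rw [h.classDist_of_periodic (fun _ => rfl) hr]
      split_ifs <;> simp_all <;> omega
  · rw [ncard_ne_eq_sum_classDist hpp] at hk
    rw [h.linearComplexity_eq hp h2 ht]
    split_ifs with h1 h3 h4 <;> try omega
    exfalso
    obtain ⟨a, ha⟩ := h3
    have hd := fun r hr => h.classDist_of_periodic (r := r) h4 hr
    have hpar : (q + q * p) % 2 = 0 := by
      rw [hpq, show q + q * (2 * q + 1) = 2 * (q * q + q) by ring]; omega
    -- For `p`-periodic `t` the parity of the class sum is the value of `t`, as `p` is odd. Hence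
    -- `t` is constant: zero is too far, and all-ones has an even number of changes, contradicting
    -- `h1`.
    by_cases hall : ∀ r < p, t r ≠ 1
    · have : ∑ r ∈ Finset.range p, classDist p s t r = p * q + (q + 1) := by
        rw [← h.sum_ones]
        refine Finset.sum_congr rfl fun r hr => ?_
        have := hall r (Finset.mem_range.1 hr)
        rw [hd r (Finset.mem_range.1 hr)]
        split_ifs <;> simp_all
      omega
    · push Not at hall
      obtain ⟨r, hr, hr1⟩ := hall
      have ha1 : a = 1 := by
        have := ha r hr
        rw [hd r hr] at this
        split_ifs at this <;> simp_all <;> omega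
      have : ∑ r ∈ Finset.range p, classDist p s t r = p * q + q := by
        rw [← hD0]
        refine Finset.sum_congr rfl fun r hr => ?_
        rw [Finset.mem_range] at hr
        have h5 := ha r hr
        rw [hd r hr] at h5 ⊢
        rw [h.classDist_of_periodic (fun _ => rfl) hr]
        split_ifs at h5 <;> simp_all <;> omega
      rw [this, mul_comm, add_comm, hpar] at h1
      omega

theorem kErrorLinearComplexity_eq_zero {k : ℕ} (hk : p * q + q + 1 ≤ k) :
    kErrorLinearComplexity (p ^ 2) s k = 0 := by
  have hpp := h.p_pos
  have hpq := h.1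
  have hd : ∀ r < p, classDist p s (fun _ => 0) r = q + if r ∈ M then 1 else 0 := fun r hr => by
    rw [h.classDist_of_periodic (fun _ => rfl) hr]
    split_ifs <;> simp_all
  have hD : ∑ r ∈ Finset.range p, classDist p s (fun _ => 0) r = p * q + (q + 1) := by
    rw [Finset.sum_congr rfl fun r hr => hd r (Finset.mem_range.1 hr), h.sum_ones]
  refine kErrorLinearComplexity_eq ⟨fun _ => 0, fun _ => rfl, ?_, ?_⟩ fun t ht hk => Nat.zero_le _
  · rw [ncard_ne_eq_sum_classDist hpp, hD]
    exact hk
  · rw [h.linearComplexity_eq hp h2 (fun _ => rfl), if_pos (c := Function.Periodic _ _) fun _ => rfl,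
      if_pos (c := ∃ a, _), hD, if_pos]
    · rw [hpq, show (2 * q + 1) * q + (q + 1) = 1 + 2 * (q * q + q) by ring]; omega
    · refine ⟨0, fun r hr => ?_⟩
      rw [hd r hr]; omega

end IsClassBalanced

/-! ### Cyclotomic classes and the number of ones in each residue class -/

/-- The union of the classes `D_{(i + b) mod F}` with `i < h`. -/
def cycUnion (p e f g b j F h : ℕ) : Finset ℕ :=
  (Finset.range h).biUnion fun i => cycClass p e f g j ((i + b) % F)

lemma pow_mod_eq_pow_mod_iff {g n : ℕ} (hg : 0 < orderOf (g : ZMod n)) (a m : ℕ) :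
    g ^ a % n = g ^ m % n ↔ a ≡ m [MOD orderOf (g : ZMod n)] := by
  rw [← (orderOf_pos_iff.1 hg).pow_eq_pow_iff_modEq]
  change g ^ a ≡ g ^ m [MOD n] ↔ _
  rw [← ZMod.natCast_eq_natCast_iff]
  push_cast
  rfl

/-- `B` acts as `-b` modulo `F` and moves the window to the origin. -/
lemma exists_lt_modEq_add_iff {b B F h m : ℕ} (hB : F ∣ b + B) (hh : h ≤ F) :
    (∃ i < h, i + b ≡ m [MOD F]) ↔ (m + B) % F < h := by
  have hB' : b + B ≡ 0 [MOD F] := (Nat.modEq_zero_iff_dvd).2 hB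
  constructor
  · rintro ⟨i, hi, him⟩
    have h1 : m + B ≡ i [MOD F] := by
      have h2 := (him.symm.add_right B)
      rw [add_assoc] at h2
      exact h2.trans (by simpa using hB'.add_left i)
    rw [h1, Nat.mod_eq_of_lt (hi.trans_le hh)]
    exact hi
  · intro hlt
    refine ⟨_, hlt, ?_⟩
    have h1 := (Nat.mod_modEq (m + B) F).add_right b
    refine h1.trans ?_
    rw [add_assoc, add_comm B]
    simpa using hB'.add_left m

/-- As `g` has order `e F`, the class `D_l` consists of the powers of `g` with exponent `≡ l` mod
`F`. -/
lemma pow_mod_mem_cycUnion {p e f g b j F h : ℕ} (hF : f * p ^ (j - 1) = F) (hF0 : 0 < F)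
    (he : 0 < e) (hg : orderOf (g : ZMod (p ^ j)) = e * F) (m : ℕ) :
    g ^ m % p ^ j ∈ cycUnion p e f g b j F h ↔ ∃ i < h, i + b ≡ m [MOD F] := by
  have hg0 : 0 < orderOf (g : ZMod (p ^ j)) := by rw [hg]; exact Nat.mul_pos he hF0
  simp only [cycUnion, cycClass, Finset.mem_biUnion, Finset.mem_image, Finset.mem_range,
    mul_assoc, hF, ← pow_add, pow_mod_eq_pow_mod_iff hg0]
  refine exists_congr fun i => and_congr_right fun _ => ?_
  rw [hg]
  constructor
  · rintro ⟨k, -, hk⟩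
    have h1 := hk.of_mul_left e
    exact ((Nat.mod_modEq (i + b) F).symm.trans (by simp [Nat.ModEq])).trans h1
  · intro hi
    refine ⟨m / F % e, Nat.mod_lt _ he, ?_⟩
    have h1 : m / F % e * F ≡ m / F * F [MOD e * F] := (Nat.mod_modEq (m / F) e).mul_right' F
    refine (h1.add_left _).trans ?_
    rw [hi, Nat.mod_add_div']

lemma exists_pow_mod_of_mem_cycUnion {p e f g b j F h n : ℕ} (hn : n ∈ cycUnion p e f g b j F h) :
    ∃ m, n = g ^ m % p ^ j := by
  simp only [cycUnion, cycClass, Finset.mem_biUnion, Finset.mem_image, Finset.mem_range] at hn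
  obtain ⟨i, -, k, -, rfl⟩ := hn
  exact ⟨_, by rw [pow_add]⟩

lemma card_cycUnion {p e f g b j F h : ℕ} (hF : f * p ^ (j - 1) = F) (hF0 : 0 < F)
    (he : 0 < e) (hg : orderOf (g : ZMod (p ^ j)) = e * F) (hh : h ≤ F) :
    (cycUnion p e f g b j F h).card = h * e := by
  have hg0 : 0 < orderOf (g : ZMod (p ^ j)) := by rw [hg]; exact Nat.mul_pos he hF0
  have key : ∀ l < F, ∀ l' < F, ∀ k < e, ∀ k' < e,
      (g ^ l * g ^ (k * f * p ^ (j - 1))) % p ^ j = (g ^ l' * g ^ (k' * f * p ^ (j - 1))) % p ^ j →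
      l = l' ∧ k = k' := by
    intro l hl l' hl' k hk k' hk' heq
    rw [← pow_add, ← pow_add, pow_mod_eq_pow_mod_iff hg0, hg, mul_assoc, mul_assoc, hF] at heq
    have hlt : ∀ l < F, ∀ k < e, l + k * F < e * F := fun l hl k hk => by
      have : (k + 1) * F ≤ e * F := Nat.mul_le_mul_right _ hk
      linarith
    have h1 := heq.eq_of_lt_of_lt (hlt l hl k hk) (hlt l' hl' k' hk')
    have h2 : l = l' := by
      have := congrArg (· % F) h1
      simpa [Nat.mod_eq_of_lt, hl, hl'] using this
    exact ⟨h2, Nat.eq_of_mul_eq_mul_right hF0 (by omega)⟩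
  have hmod : ∀ i, (i + b) % F < F := fun i => Nat.mod_lt _ hF0
  rw [cycUnion, Finset.card_biUnion]
  · have hcard : ∀ i, (cycClass p e f g j ((i + b) % F)).card = e := fun i => by
      rw [cycClass, Finset.card_image_of_injOn, Finset.card_range]
      intro k hk k' hk' heq
      exact (key _ (hmod i) _ (hmod i) k (by simpa using hk) k' (by simpa using hk') heq).2
    simp [hcard]
  · intro i hi i' hi' hne
    rw [Function.onFun, Finset.disjoint_left]
    intro n hn hn'
    simp only [cycClass, Finset.mem_image, Finset.mem_range, Finset.coe_range, Set.mem_Iio] at hn hn' hi hi'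
    obtain ⟨k, hk, rfl⟩ := hn
    obtain ⟨k', hk', heq⟩ := hn'
    have := (key _ (hmod i') _ (hmod i) k' hk' k hk heq).1
    have h3 : i' ≡ i [MOD F] := Nat.ModEq.add_right_cancel' b this
    exact hne (h3.eq_of_lt_of_lt (by omega) (by omega)).symm

/-- Lexicographic comparison of the base-`2h` digits `(y, c)` with `(q, h)`. -/
lemma mul_add_lt_iff {q h y c : ℕ} (hc : c < 2 * h) :
    2 * h * y + c < (2 * q + 1) * h ↔ y < q ∨ (y = q ∧ c < h) := by
  rcases lt_trichotomy y q with hy | rfl | hy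
  · have : h * (y + 1) ≤ h * q := Nat.mul_le_mul_left _ hy
    simp only [hy, true_or, iff_true]
    nlinarith
  · simp only [lt_irrefl, true_and, false_or]
    constructor <;> intro <;> nlinarith
  · have : h * (q + 1) ≤ h * y := Nat.mul_le_mul_left _ hy
    simp only [hy.not_gt, hy.ne', false_and, or_self, iff_false, not_lt]
    nlinarith

/-- `j ↦ Q + e j` permutes the residues mod `p`. -/
lemma card_filter_linear_mod {p e Q : ℕ} (hp : 0 < p) (he : p.Coprime e) (P : ℕ → Prop)
    [DecidablePred P] :
    ((Finset.range p).filter fun j => P ((Q + e * j) % p)).card =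
      ((Finset.range p).filter P).card := by
  have hinj : Set.InjOn (fun j => (Q + e * j) % p) (Finset.range p) := by
    intro j hj j' hj' h
    have h1 : Q + e * j ≡ Q + e * j' [MOD p] := h
    have h2 := Nat.ModEq.cancel_left_of_coprime he (Nat.ModEq.add_left_cancel' Q h1)
    exact h2.eq_of_lt_of_lt (by simpa using hj) (by simpa using hj')
  have himg : (Finset.range p).image (fun j => (Q + e * j) % p) = Finset.range p :=
    Finset.eq_of_subset_of_card_le
      (Finset.image_subset_iff.2 fun j _ => Finset.mem_range.2 (Nat.mod_lt _ hp))
      (by rw [Finset.card_image_of_injOn hinj])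
  conv_rhs => rw [← himg, Finset.filter_image]
  rw [Finset.card_image_of_injOn (hinj.mono (Finset.coe_subset.2 (Finset.filter_subset _ _)))]

/-- Among the `p` exponents `m + e f j`, `j < p`, modulo `p f` that are congruent to `m` modulo
`f`, about one half lie in the window `[b, b + p f / 2)`. -/
lemma card_filter_exists_lt_modEq {p q e h b B m : ℕ} (hpq : p = 2 * q + 1) (hh : 0 < h)
    (he : p.Coprime e) (hB : p * (2 * h) ∣ b + B) :
    ((Finset.range p).filter fun j =>
        ∃ i < p * h, i + b ≡ m + e * (2 * h) * j [MOD p * (2 * h)]).card =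
      q + if ∃ i < h, i + b ≡ m [MOD 2 * h] then 1 else 0 := by
  have hp : 0 < p := by omega
  have hf : 0 < 2 * h := by omega
  have hB' : 2 * h ∣ b + B := (Dvd.intro_left p rfl).trans hB
  set c := (m + B) % (2 * h) with hc
  have hclt : c < 2 * h := Nat.mod_lt _ hf
  set Q := (m + B) / (2 * h)
  have hQ : 2 * h * Q + c = m + B := Nat.div_add_mod _ _
  -- Modulo `2 h p` the shifted exponent has low digit `c`, fixed, and high digit `y = Q + e j` mod
  -- `p`, which takes every value once. The window contains the `q` values `y < q`, and `y = q`
  -- exactly when `c < h`, the window condition modulo `f`.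
  have hcond : ∀ j, (∃ i < p * h, i + b ≡ m + e * (2 * h) * j [MOD p * (2 * h)]) ↔
      (fun y => y < q ∨ (y = q ∧ c < h)) ((Q + e * j) % p) := by
    intro j
    rw [exists_lt_modEq_add_iff hB (Nat.mul_le_mul_left _ (by omega)),
      show m + e * (2 * h) * j + B = c + 2 * h * (Q + e * j) by rw [add_right_comm, ← hQ]; ring,
      mul_comm p (2 * h)]
    have hmod : (c + 2 * h * (Q + e * j)) % (2 * h * p) = 2 * h * ((Q + e * j) % p) + c := by
      rw [Nat.mod_mul, Nat.add_mul_mod_self_left, Nat.mod_eq_of_lt hclt,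
        Nat.add_mul_div_left _ _ hf, Nat.div_eq_of_lt hclt, zero_add, add_comm]
    rw [hmod, hpq]
    exact mul_add_lt_iff hclt
  rw [Finset.filter_congr fun j _ => hcond j,
    card_filter_linear_mod hp he (fun y => y < q ∨ (y = q ∧ c < h)),
    if_congr (exists_lt_modEq_add_iff hB' (by omega)) rfl rfl, ← hc]
  split_ifs with hch
  · rw [show (Finset.range p).filter (fun y => y < q ∨ (y = q ∧ c < h)) = Finset.range (q + 1) by
      ext y; simp only [Finset.mem_filter, Finset.mem_range, hch, and_true]; omega]
    simp
  · rw [show (Finset.range p).filter (fun y => y < q ∨ (y = q ∧ c < h)) = Finset.range q by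
      ext y; simp only [Finset.mem_filter, Finset.mem_range, hch, and_false, or_false]; omega]
    simp

lemma not_dvd_pow_mod {p g j : ℕ} (hp : p.Prime) (hj : j ≠ 0)
    (hg : 0 < orderOf (g : ZMod (p ^ j))) (m : ℕ) : ¬ p ∣ g ^ m % p ^ j := by
  intro h
  have h1 : p ∣ g ^ m := (Nat.dvd_mod_iff (dvd_pow_self p hj)).1 h
  have h2 : p ∣ g := hp.dvd_of_dvd_pow h1
  have h3 := pow_mod_eq_pow_mod_iff hg (orderOf (g : ZMod (p ^ j))) 0
  have h4 : g ^ orderOf (g : ZMod (p ^ j)) % p ^ j = g ^ 0 % p ^ j := h3.2 (by simp [Nat.ModEq])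
  have h5 : p ∣ g ^ 0 % p ^ j := by
    rw [← h4, Nat.dvd_mod_iff (dvd_pow_self p hj)]; exact dvd_pow h2 hg.ne'
  rw [Nat.dvd_mod_iff (dvd_pow_self p hj), pow_zero] at h5
  exact hp.one_lt.ne' (Nat.dvd_one.1 h5)

lemma mem_cycSupport_iff {p e f g b n : ℕ} :
    n ∈ cycSupport p e f g b ↔ (∃ v ∈ cycUnion p e f g b 1 f (f / 2), p * v = n) ∨
      n ∈ cycUnion p e f g b 2 (p * f) (p * f / 2) ∨ n = 0 := by
  simp only [cycSupport, cycUnion, Finset.mem_union, Finset.mem_biUnion, Finset.mem_image,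
    Finset.mem_singleton, or_assoc]
  refine or_congr_left ⟨?_, ?_⟩
  · rintro ⟨i, hi, v, hv, rfl⟩
    exact ⟨v, ⟨i, hi, hv⟩, rfl⟩
  · rintro ⟨v, ⟨i, hi, hv⟩, rfl⟩
    exact ⟨i, hi, v, hv, rfl⟩

lemma cycSeq_eq_one_iff {p e f g b n : ℕ} (hn : n < p ^ 2) :
    cycSeq p e f g b n = 1 ↔ n ∈ cycSupport p e f g b := by
  simp [cycSeq, Nat.mod_eq_of_lt hn]

/-- The set of residues defining the ones among multiples of `p`, with 0 added, serves as `M`. It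
has `e f / 2 + 1 = q + 1` elements, which counts class 0. A class `r = g ^ m` mod `p` consists of
the `g ^ (m + e f j)`, `j < p`, and the window count yields the extra one exactly when `r` lies in
`M`. -/
theorem cycSeq_isClassBalanced {p q e f g b : ℕ} (hp : p.Prime) (hpq : p = 2 * q + 1)
    (hef : p - 1 = e * f) (hf : Even f)
    (hg : orderOf (g : ZMod (p ^ 2)) = Nat.totient (p ^ 2)) :
    IsClassBalanced p q (cycSeq p e f g b) (insert 0 (cycUnion p e f g b 1 f (f / 2))) := by
  have hq : 0 < q := by have := hp.two_le; omega
  have hp0 := hp.pos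
  obtain ⟨h, rfl⟩ := hf.two_dvd
  have hqe : q = e * h := by
    have : 2 * q = 2 * (e * h) := by rw [mul_left_comm, ← hef]; omega
    omega
  have he0 : 0 < e := Nat.pos_of_ne_zero (by rintro rfl; omega)
  have hh0 : 0 < h := Nat.pos_of_ne_zero (by rintro rfl; omega)
  have hf0 : 0 < 2 * h := by omega
  have hg1 : orderOf (g : ZMod (p ^ 1)) = e * (2 * h) := by
    rw [pow_one, orderOf_natCast_zmod_prime hp hg, hef]
  have hg2 : orderOf (g : ZMod (p ^ 2)) = e * (p * (2 * h)) := by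
    rw [hg, Nat.totient_prime_pow hp (by norm_num), hef]; ring
  have hg1p : 0 < orderOf (g : ZMod (p ^ 1)) := by rw [hg1]; positivity
  have hg2p : 0 < orderOf (g : ZMod (p ^ 2)) := by rw [hg2]; positivity
  have hcop : p.Coprime e := by
    rw [hp.coprime_iff_not_dvd]
    intro hd
    have := Nat.le_of_dvd he0 hd
    nlinarith
  have hfh : 2 * h / 2 = h := by omega
  have hpfh : p * (2 * h) / 2 = p * h := by rw [mul_left_comm]; simp
  rw [hfh]
  have h0 : 0 ∉ cycUnion p e (2 * h) g b 1 (2 * h) h := by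
    intro hmem
    obtain ⟨m, hm⟩ := exists_pow_mod_of_mem_cycUnion hmem
    exact not_dvd_pow_mod hp one_ne_zero hg1p m (hm ▸ dvd_zero p)
  have hsub : ∀ v ∈ cycUnion p e (2 * h) g b 1 (2 * h) h, v < p := fun v hv => by
    obtain ⟨m, rfl⟩ := exists_pow_mod_of_mem_cycUnion hv
    rw [pow_one]; exact Nat.mod_lt _ hp0
  have hcard : (insert 0 (cycUnion p e (2 * h) g b 1 (2 * h) h)).card = q + 1 := by
    rw [Finset.card_insert_of_notMem h0, card_cycUnion (by simp) hf0 he0 hg1 (by omega), hqe,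
      mul_comm]
  have hsubM : insert 0 (cycUnion p e (2 * h) g b 1 (2 * h) h) ⊆ Finset.range p := by
    intro v hv
    rw [Finset.mem_insert] at hv
    rcases hv with rfl | hv
    · simpa using hp0
    · simpa using hsub v hv
  refine ⟨hpq, hq, fun n => by simp [cycSeq], hsubM, hcard, fun r hr => ?_⟩
  rcases Nat.eq_zero_or_pos r with rfl | hr0
  · rw [if_pos (Finset.mem_insert_self _ _), ← hcard, Finset.card_filter, sum_residueClass hr,
      ← Finset.card_filter]
    congr 1
    ext j
    rw [Finset.mem_filter, Finset.mem_range, zero_add]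
    constructor
    · rintro ⟨hj, hs⟩
      rw [cycSeq_eq_one_iff (by rw [sq]; exact Nat.mul_lt_mul_of_pos_left hj hp0),
        mem_cycSupport_iff, hfh] at hs
      rcases hs with ⟨v, hv, hvj⟩ | hm | hj0
      · rw [Nat.eq_of_mul_eq_mul_left hp0 hvj] at hv
        exact Finset.mem_insert_of_mem hv
      · obtain ⟨m, hm⟩ := exists_pow_mod_of_mem_cycUnion hm
        exact absurd (hm ▸ dvd_mul_right p j) (not_dvd_pow_mod hp two_ne_zero hg2p m)
      · rw [(Nat.mul_eq_zero.1 hj0).resolve_left hp0.ne']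
        exact Finset.mem_insert_self _ _
    · intro hj
      have hjp := Finset.mem_range.1 (hsubM hj)
      refine ⟨hjp, ?_⟩
      rw [cycSeq_eq_one_iff (by rw [sq]; exact Nat.mul_lt_mul_of_pos_left hjp hp0),
        mem_cycSupport_iff, hfh]
      rw [Finset.mem_insert] at hj
      rcases hj with rfl | hj
      · simp
      · exact Or.inl ⟨j, hj, rfl⟩
  · obtain ⟨m, rfl⟩ : ∃ m, g ^ m % p = r := by
      have hinj : Set.InjOn (fun m => g ^ m % p) (Finset.range (p - 1)) := by
        intro m hm m' hm' heq
        rw [Finset.coe_range, Set.mem_Iio, hef, ← hg1, pow_one] at hm hm'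
        rw [pow_one] at hg1p
        exact ((pow_mod_eq_pow_mod_iff hg1p m m').1 heq).eq_of_lt_of_lt hm hm'
      have himg : (Finset.range (p - 1)).image (fun m => g ^ m % p) = Finset.Ico 1 p := by
        refine Finset.eq_of_subset_of_card_le (Finset.image_subset_iff.2 fun m _ => ?_)
          (by rw [Finset.card_image_of_injOn hinj]; simp)
        rw [Finset.mem_Ico]
        refine ⟨Nat.pos_of_ne_zero fun hz => ?_, Nat.mod_lt _ hp0⟩
        have := not_dvd_pow_mod hp one_ne_zero hg1p m
        rw [pow_one, hz] at this
        exact this (dvd_zero p)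
      have hmem : r ∈ (Finset.range (p - 1)).image (fun m => g ^ m % p) := by
        rw [himg, Finset.mem_Ico]; exact ⟨hr0, hr⟩
      obtain ⟨m, -, hm⟩ := Finset.mem_image.1 hmem
      exact ⟨m, hm⟩
    have hpdvd : p ∣ p ^ 2 := dvd_pow_self p two_ne_zero
    have hinj : Set.InjOn (fun j => g ^ (m + e * (2 * h) * j) % p ^ 2) (Finset.range p) := by
      intro j hj j' hj' heq
      have h1 := (pow_mod_eq_pow_mod_iff hg2p _ _).1 heq
      rw [hg2, show e * (p * (2 * h)) = e * (2 * h) * p by ring] at h1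
      have h2 := Nat.ModEq.mul_left_cancel' (by positivity) (Nat.ModEq.add_left_cancel' m h1)
      exact h2.eq_of_lt_of_lt (by simpa using hj) (by simpa using hj')
    have himg : (Finset.range p).image (fun j => g ^ (m + e * (2 * h) * j) % p ^ 2) =
        residueClass p (g ^ m % p) := by
      refine Finset.eq_of_subset_of_card_le (Finset.image_subset_iff.2 fun j _ => ?_)
        (by rw [Finset.card_image_of_injOn hinj, card_residueClass hr]; simp)
      rw [residueClass, Finset.mem_filter, Finset.mem_range]
      refine ⟨Nat.mod_lt _ (by positivity), ?_⟩
      rw [Nat.mod_mod_of_dvd _ hpdvd]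
      rw [pow_one] at hg1p hg1
      rw [pow_mod_eq_pow_mod_iff hg1p, hg1]
      simp [Nat.ModEq]
    rw [← himg, Finset.filter_image, Finset.card_image_of_injOn (hinj.mono (Finset.coe_subset.2 (Finset.filter_subset _ _)))]
    have hcond : ∀ j, cycSeq p e (2 * h) g b (g ^ (m + e * (2 * h) * j) % p ^ 2) = 1 ↔
        ∃ i < p * h, i + b ≡ m + e * (2 * h) * j [MOD p * (2 * h)] := by
      intro j
      have hnd := not_dvd_pow_mod hp two_ne_zero hg2p (m + e * (2 * h) * j)
      rw [cycSeq_eq_one_iff (Nat.mod_lt _ (by positivity)), mem_cycSupport_iff, hpfh,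
        pow_mod_mem_cycUnion (by simp [mul_comm]) (by positivity) he0 hg2]
      constructor
      · rintro (⟨v, -, hv⟩ | hi | hz)
        · exact absurd (hv ▸ dvd_mul_right p v) hnd
        · exact hi
        · exact absurd (hz ▸ dvd_zero p) hnd
      · exact fun hi => Or.inr (Or.inl hi)
    -- This `B` gives `b + B = b p f`.
    rw [Finset.filter_congr fun j _ => hcond j,
      card_filter_exists_lt_modEq hpq hh0 hcop (B := b * (p * (2 * h) - 1)) ?_]
    · congr 1
      refine if_congr ?_ rfl rfl
      rw [Finset.mem_insert, or_iff_right hr0.ne']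
      have := pow_mod_mem_cycUnion (b := b) (h := h) (f := 2 * h) (j := 1) (by simp) hf0 he0 hg1 m
      rw [← this, pow_one]
    · have : 0 < p * (2 * h) := by positivity
      refine ⟨b, ?_⟩
      obtain ⟨d, hd⟩ := Nat.exists_eq_succ_of_ne_zero this.ne'
      rw [hd, Nat.succ_eq_add_one, Nat.add_sub_cancel]; ring

theorem theorem2 (p e f g b : ℕ) (hp : p.Prime) (hef : p - 1 = e * f) (hf : Even f)
    (hg : orderOf (g : ZMod (p ^ 2)) = Nat.totient (p ^ 2))
    (h2 : orderOf (2 : ZMod (p ^ 2)) = Nat.totient (p ^ 2)) :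
    (p % 8 = 3 → ∀ k : ℕ,
      (k = 0 →
        kErrorLinearComplexity (p ^ 2) (cycSeq p e f g b) k = p ^ 2) ∧
      (1 ≤ k → k < (p - 1) / 2 →
        kErrorLinearComplexity (p ^ 2) (cycSeq p e f g b) k = p ^ 2 - 1) ∧
      ((p - 1) / 2 ≤ k → k < (p ^ 2 - p) / 2 →
        kErrorLinearComplexity (p ^ 2) (cycSeq p e f g b) k = p ^ 2 - p) ∧
      (k = (p ^ 2 - p) / 2 →
        kErrorLinearComplexity (p ^ 2) (cycSeq p e f g b) k = p - 1) ∧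
      (k = (p ^ 2 - 1) / 2 →
        kErrorLinearComplexity (p ^ 2) (cycSeq p e f g b) k = 1) ∧
      ((p ^ 2 + 1) / 2 ≤ k →
        kErrorLinearComplexity (p ^ 2) (cycSeq p e f g b) k = 0)) ∧
    (p % 8 = 5 → ∀ k : ℕ,
      (k = 0 →
        kErrorLinearComplexity (p ^ 2) (cycSeq p e f g b) k = p ^ 2) ∧
      (1 ≤ k → k < (p - 1) / 2 →
        kErrorLinearComplexity (p ^ 2) (cycSeq p e f g b) k = p ^ 2 - 1) ∧
      (k = (p - 1) / 2 →
        kErrorLinearComplexity (p ^ 2) (cycSeq p e f g b) k = p ^ 2 - p + 1) ∧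
      ((p + 1) / 2 ≤ k → k < (p ^ 2 - p) / 2 →
        kErrorLinearComplexity (p ^ 2) (cycSeq p e f g b) k = p ^ 2 - p) ∧
      (k = (p ^ 2 - p) / 2 →
        kErrorLinearComplexity (p ^ 2) (cycSeq p e f g b) k = p) ∧
      (k = (p ^ 2 - 1) / 2 →
        kErrorLinearComplexity (p ^ 2) (cycSeq p e f g b) k = 1) ∧
      ((p ^ 2 + 1) / 2 ≤ k →
        kErrorLinearComplexity (p ^ 2) (cycSeq p e f g b) k = 0)) := by

  constructor
  · intro h8 k
    obtain ⟨q, hpq⟩ : ∃ q, p = 2 * q + 1 := ⟨p / 2, by omega⟩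
    have h := cycSeq_isClassBalanced (b := b) hp hpq hef hf hg
    have hq : q % 2 = 1 := by omega
    have e1 : (p - 1) / 2 = q := by omega
    have e2 : p ^ 2 = 2 * (p * q) + p := by rw [sq]; nth_rw 2 [hpq]; ring
    have e3 : (p ^ 2 - p) / 2 = p * q := by omega
    have e4 : (p ^ 2 - 1) / 2 = p * q + q := by omega
    have e5 : (p ^ 2 + 1) / 2 = p * q + q + 1 := by omega
    rw [e1, e3, e4, e5]
    refine ⟨?_, h.kErrorLinearComplexity_of_lt hp h2, h.kErrorLinearComplexity_of_odd hp h2 hq,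
      ?_, ?_, h.kErrorLinearComplexity_eq_zero hp h2⟩
    · rintro rfl; exact h.kErrorLinearComplexity_zero hp h2
    · rintro rfl; rw [h.kErrorLinearComplexity_mul hp h2, if_pos hq]
    · rintro rfl; exact h.kErrorLinearComplexity_eq_one hp h2
  · intro h8 k
    obtain ⟨q, hpq⟩ : ∃ q, p = 2 * q + 1 := ⟨p / 2, by omega⟩
    have h := cycSeq_isClassBalanced (b := b) hp hpq hef hf hg
    have hq : q % 2 = 0 := by omega
    have e1 : (p - 1) / 2 = q := by omega
    have e1' : (p + 1) / 2 = q + 1 := by omega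
    have e2 : p ^ 2 = 2 * (p * q) + p := by rw [sq]; nth_rw 2 [hpq]; ring
    have e3 : (p ^ 2 - p) / 2 = p * q := by omega
    have e4 : (p ^ 2 - 1) / 2 = p * q + q := by omega
    have e5 : (p ^ 2 + 1) / 2 = p * q + q + 1 := by omega
    rw [e1, e1', e3, e4, e5]
    refine ⟨?_, h.kErrorLinearComplexity_of_lt hp h2, ?_,
      h.kErrorLinearComplexity_of_even hp h2 hq, ?_, ?_, h.kErrorLinearComplexity_eq_zero hp h2⟩
    · rintro rfl; exact h.kErrorLinearComplexity_zero hp h2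
    · rintro rfl; exact h.kErrorLinearComplexity_of_even_eq hp h2 hq
    · rintro rfl; rw [h.kErrorLinearComplexity_mul hp h2, if_neg (by omega)]
    · rintro rfl; exact h.kErrorLinearComplexity_eq_one hp h2
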